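/- Let $k$ be a field, $X$ a projective $k$-scheme of dimension $d\ge 1$, and $D\subset X$ an ample effective Cartier divisor. Put $\square^n=\mathbb A^n_k\subset(\mathbb P^1_k)^n$ with coordinates $y_1,\dots,y_n$, and $F_n^\infty=\sum_{i=1}^n\{y_i=\infty\}$. A face of $\square^n$ is a closed subscheme defined by equations $y_{i_1}=\epsilon_1,\dots,y_{i_r}=\epsilon_r$ with $\epsilon_j\in\{0,1\}$. For $s\in\mathbb Z$ and $n\ge 0$ let $\underline z_s(X|D,n)$ be the free abelian group on the integral closed subschemes $V\subset X\times\square^n$ of dimension $s+n$ such that (1) $V$ intersects $X\times F$ properly for each face $F$ of $\square^n$, and (2) $\nu^*(D\times(\mathbb P^1_k)^n)\le\nu^*(X\times F_n^\infty)$ as effective Cartier divisors on $\overline V^N$ (in particular both pullbacks are defined), where $\nu:\overline V^N\to X\times(\mathbb P^1_k)^n$ is the normalization of the closure $\overline V$ of $V$ in $X\times(\mathbb P^1_k)^n$, followed by the inclusion. Let $z_s(X|D,n)$ be the quotient of $\underline z_s(X|D,n)$ by the subgroup of degenerate cycles, which is generated by the pullbacks of the elements of $\underline z_s(X|D,n-1)$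 along the projections $X\times\square^n\to X\times\square^{n-1}$ that forget one coordinate. These groups form a complex with boundary $\partial=\sum_{i=1}^n(-1)^i(\partial_i^0-\partial_i^1)$, where $\partial_i^\epsilon$ is the pullback to the face $y_i=\epsilon$; let $\mathrm{CH}_s(X|D,n)=H_n(z_s(X|D,\bullet))$. Then $z_s(X|D,p)=0$ for all integers $s>0$ and all $p\ge 0$. In particular, $\mathrm{CH}_s(X|D,p)=0$ for all $s>0$ and $p\ge 0$. -/

import Mathlib

open CategoryTheory CategoryTheory.Limits AlgebraicGeometry TopologicalSpace

universe u

noncomputable section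

namespace ModulusCycles

attribute [local instance] MvPolynomial.gradedAlgebra

/-! ## Projective space, projective schemes -/

/-- Projective space `ℙ^N_k = Proj k[Y_0, …, Y_N]`. -/
abbrev projSpace (k : Type u) [Field k] (N : ℕ) : Scheme.{u} :=
  Proj (MvPolynomial.homogeneousSubmodule (Fin (N + 1)) k)

/-- The structure morphism `ℙ^N_k ⟶ Spec k`. -/
abbrev projSpaceStr (k : Type u) [Field k] (N : ℕ) : projSpace k N ⟶ Spec (.of k) :=
  Proj.toSpecZero (MvPolynomial.homogeneousSubmodule (Fin (N + 1)) k) ≫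
    Spec.map (CommRingCat.ofHom
      (algebraMap k (MvPolynomial.homogeneousSubmodule (Fin (N + 1)) k 0)))

/-- A `k`-scheme is projective if it is isomorphic over `k` to a closed subscheme of some
`ℙ^N_k`. -/
def IsProjectiveOver {k : Type u} [Field k] {X : Scheme.{u}} (π : X ⟶ Spec (.of k)) : Prop :=
  ∃ (N : ℕ) (i : X ⟶ projSpace k N), IsClosedImmersion i ∧ i ≫ projSpaceStr k N = π

/-! ## Effective Cartier divisors -/

/-- An ideal sheaf defines an effective Cartier divisor if it is locally generated by one
nonzerodivisor. -/
def IsEffCartier {X : Scheme.{u}} (I : X.IdealSheafData) : Prop :=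
  ∀ x : X, ∃ U : X.affineOpens, x ∈ U.1 ∧
    ∃ f ∈ nonZeroDivisors Γ(X, U.1), I.ideal U = Ideal.span {f}

/-- `D₁ ≤ D₂` for effective Cartier divisors given by their ideal sheaves: both are effective
Cartier divisors, and `D₁ + E = D₂` for an effective Cartier divisor `E`. The ideal sheaf of a sum
of divisors is the product of the ideal sheaves. -/
def DivLE {X : Scheme.{u}} (I₁ I₂ : X.IdealSheafData) : Prop :=
  IsEffCartier I₁ ∧ IsEffCartier I₂ ∧ ∃ J : X.IdealSheafData, IsEffCartier J ∧ I₁ * J = I₂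

/-- A global section of `𝒪_X(nD) = ℋom(I^n, 𝒪_X)`, where `I` is the ideal sheaf of the effective
Cartier divisor `D`, given by its values on affine open subsets. -/
structure DivSection {X : Scheme.{u}} (I : X.IdealSheafData) (n : ℕ) where
  /-- the value on an affine open subset -/
  toLin : ∀ U : X.affineOpens, (I ^ n).ideal U →ₗ[Γ(X, U.1)] Γ(X, U.1)
  /-- compatibility with restriction -/
  compat : ∀ (U V : X.affineOpens) (h : V ≤ U) (a : Γ(X, U.1)) (ha : a ∈ (I ^ n).ideal U),
    toLin V ⟨(X.presheaf.map (homOfLE h).op).hom a, (I ^ n).ideal_le_comap_ideal h ha⟩ =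
      (X.presheaf.map (homOfLE h).op).hom (toLin U ⟨a, ha⟩)

/-- The locus `X_s` where a section `s` of the invertible sheaf `𝒪_X(nD)` generates it, that is,
where `s : I^n ⟶ 𝒪_X` is locally surjective (equivalently, an isomorphism). -/
def DivSection.nonvanishing {X : Scheme.{u}} {I : X.IdealSheafData} {n : ℕ}
    (s : DivSection I n) : Set X :=
  {x | ∃ U : X.affineOpens, x ∈ U.1 ∧ Function.Surjective (s.toLin U)}

/-- The invertible sheaf `𝒪_X(D)` of an effective Cartier divisor `D` with ideal sheaf `I` is
ample: `X` is quasi-compact and every point lies in an affine open subset of the form `X_s`, where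
`s` is a global section of `𝒪_X(nD)` and `n ≥ 1`. -/
def IsAmpleDiv {X : Scheme.{u}} (I : X.IdealSheafData) : Prop :=
  CompactSpace X ∧
    ∀ x : X, ∃ (n : ℕ) (s : DivSection I n) (W : X.Opens),
      1 ≤ n ∧ IsAffineOpen W ∧ (W : Set X) = s.nonvanishing ∧ x ∈ W

/-! ## The cubes `□^n` and their compactifications -/

/-- `□^n = 𝔸^n_k = Spec k[y_1, …, y_n]`. -/
abbrev cube (k : Type u) [Field k] (n : ℕ) : Scheme.{u} :=
  Spec (.of (MvPolynomial (Fin n) k))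

/-- The structure morphism `□^n ⟶ Spec k`. -/
abbrev cubeStr (k : Type u) [Field k] (n : ℕ) : cube k n ⟶ Spec (.of k) :=
  Spec.map (CommRingCat.ofHom (algebraMap k (MvPolynomial (Fin n) k)))

/-- The morphism of cubes given by polynomials. -/
def cubeMap {k : Type u} [Field k] {m n : ℕ} (g : Fin n → MvPolynomial (Fin m) k) :
    cube k m ⟶ cube k n :=
  Spec.map (CommRingCat.ofHom (MvPolynomial.aeval (R := k) g).toRingHom)

lemma cubeMap_str {k : Type u} [Field k] {m n : ℕ} (g : Fin n → MvPolynomial (Fin m) k) :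
    cubeMap g ≫ cubeStr k n = cubeStr k m := by
  rw [cubeMap, cubeStr, cubeStr, ← Spec.map_comp, ← CommRingCat.ofHom_comp]
  congr 2
  ext x
  simp

/-- The compactified cube `(ℙ^1_k)^n`, a fibre power over `Spec k`. -/
abbrev cubeBar (k : Type u) [Field k] (n : ℕ) : Scheme.{u} :=
  widePullback (Spec (.of k)) (fun _ : Fin n => projSpace k 1) (fun _ => projSpaceStr k 1)

/-- The structure morphism `(ℙ^1_k)^n ⟶ Spec k`. -/
abbrev cubeBarStr (k : Type u) [Field k] (n : ℕ) : cubeBar k n ⟶ Spec (.of k) :=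
  WidePullback.base (fun _ : Fin n => projSpaceStr k 1)

/-- The projection `(ℙ^1_k)^n ⟶ ℙ^1_k` to the `i`-th factor. -/
def cubeBarProj (k : Type u) [Field k] {n : ℕ} (i : Fin n) : cubeBar k n ⟶ projSpace k 1 :=
  WidePullback.π (fun _ : Fin n => projSpaceStr k 1) i

/-- The ideal sheaf of the point `∞ = {Y_1 = 0}` of `ℙ^1_k` (with its reduced structure); the
coordinate on `ℙ^1_k` is `y = Y_0 / Y_1`. -/
def inftyIdeal (k : Type u) [Field k] : (projSpace k 1).IdealSheafData :=
  Scheme.IdealSheafData.vanishingIdeal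
    (X := Proj (MvPolynomial.homogeneousSubmodule (Fin (1 + 1)) k))
    ⟨((Proj.basicOpen (MvPolynomial.homogeneousSubmodule (Fin (1 + 1)) k)
      (MvPolynomial.X 1) : Set _))ᶜ,
      (Proj.basicOpen (MvPolynomial.homogeneousSubmodule (Fin (1 + 1)) k)
        (MvPolynomial.X 1)).isOpen.isClosed_compl⟩

/-- The ideal sheaf of the divisor `F_n^∞ = ∑ᵢ {y_i = ∞}` on `(ℙ^1_k)^n`. -/
def cubeInfty (k : Type u) [Field k] (n : ℕ) : (cubeBar k n).IdealSheafData :=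
  ∏ i : Fin n, (inftyIdeal k).comap (cubeBarProj k i)

/-- The homomorphism `k[Y_0, Y_1] → Γ(□^n, 𝒪)`, `Y_0 ↦ y_i`, `Y_1 ↦ 1`. -/
def coordHom (k : Type u) [Field k] {n : ℕ} (i : Fin n) :
    MvPolynomial (Fin (1 + 1)) k →+* Γ(cube k n, ⊤) :=
  (Scheme.ΓSpecIso (.of (MvPolynomial (Fin n) k))).inv.hom.comp
    (MvPolynomial.aeval (R := k)
      (![MvPolynomial.X i, 1] : Fin (1 + 1) → MvPolynomial (Fin n) k)).toRingHom

lemma coordHom_irrelevant (k : Type u) [Field k] {n : ℕ} (i : Fin n) :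
    (HomogeneousIdeal.irrelevant
      (MvPolynomial.homogeneousSubmodule (Fin (1 + 1)) k)).toIdeal.map (coordHom k i) = ⊤ := by
  rw [Ideal.eq_top_iff_one]
  have h1 : coordHom k i (MvPolynomial.X 1) = 1 := by
    change (Scheme.ΓSpecIso (.of (MvPolynomial (Fin n) k))).inv.hom
      (MvPolynomial.aeval (R := k)
        (![MvPolynomial.X i, 1] : Fin (1 + 1) → MvPolynomial (Fin n) k) (MvPolynomial.X 1)) = _
    rw [MvPolynomial.aeval_X]
    exact map_one _
  rw [← h1]
  refine Ideal.mem_map_of_mem _ ?_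
  change MvPolynomial.X 1 ∈ HomogeneousIdeal.irrelevant _
  rw [HomogeneousIdeal.mem_irrelevant_iff, GradedRing.proj_apply]
  exact DirectSum.decompose_of_mem_ne _ (MvPolynomial.isHomogeneous_X k (1 : Fin (1 + 1)))
    one_ne_zero

/-- The `i`-th coordinate `□^n ⟶ 𝔸^1_k ⊂ ℙ^1_k`, that is, `[y_i : 1]`. -/
def cubeCoord (k : Type u) [Field k] {n : ℕ} (i : Fin n) : cube k n ⟶ projSpace k 1 :=
  Proj.fromOfGlobalSections (MvPolynomial.homogeneousSubmodule (Fin (1 + 1)) k)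
    (coordHom k i) (coordHom_irrelevant k i)

lemma cubeCoord_str (k : Type u) [Field k] {n : ℕ} (i : Fin n) :
    cubeCoord k i ≫ projSpaceStr k 1 = cubeStr k n := by
  unfold cubeCoord projSpaceStr cubeStr
  rw [Proj.fromOfGlobalSections_toSpecZero_assoc, ← Spec.map_comp, ← CommRingCat.ofHom_comp]
  have h : CommRingCat.ofHom (((coordHom k i).comp (algebraMap
        (MvPolynomial.homogeneousSubmodule (Fin (1 + 1)) k 0)
        (MvPolynomial (Fin (1 + 1)) k))).comp
        (algebraMap k (MvPolynomial.homogeneousSubmodule (Fin (1 + 1)) k 0))) =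
      CommRingCat.ofHom (algebraMap k (MvPolynomial (Fin n) k)) ≫
        (Scheme.ΓSpecIso (.of (MvPolynomial (Fin n) k))).inv := by
    ext x
    change (Scheme.ΓSpecIso (.of (MvPolynomial (Fin n) k))).inv.hom
      (MvPolynomial.aeval (R := k)
        (![MvPolynomial.X i, 1] : Fin (1 + 1) → MvPolynomial (Fin n) k) (MvPolynomial.C x)) = _
    rw [MvPolynomial.aeval_C]
    rfl
  rw [h, Spec.map_comp, ← Category.assoc, toSpecΓ_SpecMap_ΓSpecIso_inv, Category.id_comp]

/-- The open immersion `□^n ⟶ (ℙ^1_k)^n`. -/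
def cubeEmb (k : Type u) [Field k] (n : ℕ) : cube k n ⟶ cubeBar k n :=
  WidePullback.lift (cubeStr k n) (fun i => cubeCoord k i) (fun i => cubeCoord_str k i)

lemma cubeEmb_str (k : Type u) [Field k] (n : ℕ) :
    cubeEmb k n ≫ cubeBarStr k n = cubeStr k n :=
  WidePullback.lift_base _ _ _ _

/-! ## Products with cubes -/

section Products

variable {k : Type u} [Field k] {X : Scheme.{u}} (π : X ⟶ Spec (.of k))

/-- `X × □^n`. -/
abbrev XCube (n : ℕ) : Scheme.{u} := pullback π (cubeStr k n)

/-- `X × (ℙ^1)^n`. -/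
abbrev XCubeBar (n : ℕ) : Scheme.{u} := pullback π (cubeBarStr k n)

/-- The open immersion `X × □^n ⟶ X × (ℙ^1)^n`. -/
def XCubeEmb (n : ℕ) : XCube π n ⟶ XCubeBar π n :=
  pullback.lift (pullback.fst _ _) (pullback.snd _ _ ≫ cubeEmb k n)
    (by rw [Category.assoc, cubeEmb_str, pullback.condition])

/-- The morphism `id_X × g : X × □^m ⟶ X × □^n` for a polynomial map `g : □^m ⟶ □^n`. -/
def XCubeMap {m n : ℕ} (g : Fin n → MvPolynomial (Fin m) k) : XCube π m ⟶ XCube π n :=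
  pullback.lift (pullback.fst _ _) (pullback.snd _ _ ≫ cubeMap g)
    (by rw [Category.assoc, cubeMap_str, pullback.condition])

/-- The closed immersion `(y_1, …, y_n) ↦ (y_1, …, y_{i-1}, ε, y_i, …, y_n)` of
`X × □^n` into `X × □^{n+1}` (with `ε = 0` or `ε = 1`). -/
def faceMap (n : ℕ) (i : Fin (n + 1)) (ε : Fin 2) : XCube π n ⟶ XCube π (n + 1) :=
  XCubeMap π (i.insertNth (α := fun _ => MvPolynomial (Fin n) k)
    (if ε = 0 then 0 else 1) MvPolynomial.X)

/-- The projection `X × □^{n+1} ⟶ X × □^n` forgetting the `i`-th coordinate of the cube. -/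
def degenMap (n : ℕ) (i : Fin (n + 1)) : XCube π (n + 1) ⟶ XCube π n :=
  XCubeMap π (fun j => MvPolynomial.X (i.succAbove j))

/-- The coordinate function `y_i` on `X × □^n`. -/
def coordFun {n : ℕ} (i : Fin n) : Γ(XCube π n, ⊤) :=
  (pullback.snd π (cubeStr k n)).appTop.hom
    ((Scheme.ΓSpecIso (.of (MvPolynomial (Fin n) k))).inv.hom (MvPolynomial.X i))

/-- The closed subset `X × F` of `X × □^n`, where `F` is the face with equations `y_i = ε` for all
`i`, `ε` such that `a i = some ε`. -/
def faceSet {n : ℕ} (a : Fin n → Option (Fin 2)) : Set (XCube π n) :=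
  {z | ∀ i ε, a i = some ε →
    z ∉ (XCube π n).basicOpen (coordFun π i - (if ε = 0 then 0 else 1))}

/-- The codimension in `□^n` of the face given by `a`. -/
def faceCodim {n : ℕ} (a : Fin n → Option (Fin 2)) : ℕ :=
  (Finset.univ.filter fun i => (a i).isSome).card

/-! ## Admissible cycles

As usual, an integral closed subscheme of a scheme is given by its generic point `v`: it is the
closure of `v` with its reduced structure. -/

/-- Face condition: `V` (the closure of `v`) intersects `X × F` properly for all faces `F`, that is,
`dim (V ∩ (X × F)) ≤ dim V - codim F`. The intersection may be empty. -/
def FaceCondition {n : ℕ} (v : XCube π n) : Prop :=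
  ∀ a : Fin n → Option (Fin 2),
    topologicalKrullDim ↥(closure {v} ∩ faceSet π a) + (faceCodim a : WithBot ℕ∞) ≤
      topologicalKrullDim ↥(closure {v})

end Products

instance quasiCompact_fromSpecResidueField (Y : Scheme.{u}) (y : Y) :
    QuasiCompact (Y.fromSpecResidueField y) where
  isCompact_preimage U _ _ := by
    exact (Set.toFinite _).isCompact

/-- The normalization of the closed integral subscheme of `Y` with generic point `y`: the relative
normalization of `Y` in the function field of that subscheme, which is the residue field at `y`. -/
def normalizationAt (Y : Scheme.{u}) (y : Y) : Scheme.{u} :=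
  (Y.fromSpecResidueField y).normalization

/-- The morphism `ν` from the normalization of the closed integral subscheme with generic
point `y` to `Y`: the normalization followed by the closed immersion. -/
def normalizationAtMap (Y : Scheme.{u}) (y : Y) : normalizationAt Y y ⟶ Y :=
  (Y.fromSpecResidueField y).fromNormalization

section Cycles

variable {k : Type u} [Field k] {X : Scheme.{u}} (π : X ⟶ Spec (.of k))

/-- Modulus condition for `V` (the closure of `v`): `ν^*(D × (ℙ^1)^n) ≤ ν^*(X × F_n^∞)` on the
normalization of the closure of `V` in `X × (ℙ^1)^n`. -/
def ModulusCondition (D : X.IdealSheafData) {n : ℕ} (v : XCube π n) : Prop :=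
  DivLE
    ((D.comap (pullback.fst π (cubeBarStr k n))).comap
      (normalizationAtMap (XCubeBar π n) (XCubeEmb π n v)))
    (((cubeInfty k n).comap (pullback.snd π (cubeBarStr k n))).comap
      (normalizationAtMap (XCubeBar π n) (XCubeEmb π n v)))

/-- `v` is the generic point of an integral closed subscheme of `X × □^n` of dimension `s + n` that
satisfies the face condition and has modulus `D`. -/
structure IsAdmissible (D : X.IdealSheafData) (s : ℤ) {n : ℕ} (v : XCube π n) : Prop where
  dim : ∃ m : ℕ, topologicalKrullDim ↥(closure {v}) = (m : WithBot ℕ∞) ∧ (m : ℤ) = s + n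
  face : FaceCondition π v
  modulus : ModulusCondition π D v

/-- Cycles on a scheme: the free abelian group on the integral closed subschemes (given by their
generic points). -/
abbrev Cyc (Y : Scheme.{u}) : Type u := Y →₀ ℤ

/-- The cycle on `Y` of the closed subscheme `Z` with ideal sheaf `I`: the sum over the irreducible
components of `Z`, with the length of the local ring of `Z` at the generic point as multiplicity. -/
def cycleOfIdeal {Y : Scheme.{u}} (I : Y.IdealSheafData) : Cyc Y :=
  ∑ᶠ z ∈ {z : I.subscheme | closure {z} ∈ irreducibleComponents I.subscheme},
    Finsupp.single (I.subschemeι z)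
      ((Module.length (I.subscheme.presheaf.stalk z) (I.subscheme.presheaf.stalk z)).toNat : ℤ)

/-- Pullback of cycles, `[V] ↦ [f⁻¹(V)]`. This is the flat pullback if `f` is flat, and the
intersection product with an effective Cartier divisor if `f` is the inclusion of that divisor and
`V` is not contained in it. -/
def cyclePullback {Y Z : Scheme.{u}} (f : Y ⟶ Z) : Cyc Z →+ Cyc Y :=
  Finsupp.liftAddHom fun v => (zmultiplesHom (Cyc Y)) (cycleOfIdeal
    ((Scheme.IdealSheafData.vanishingIdeal ⟨closure {v}, isClosed_closure⟩).comap f))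

/-- The group of admissible cycles of dimension `s + n` on `X × □^n` with modulus `D`, free on the
admissible integral closed subschemes. -/
def admCycles (D : X.IdealSheafData) (s : ℤ) (n : ℕ) : AddSubgroup (Cyc (XCube π n)) :=
  AddSubgroup.closure {c | ∃ v : XCube π n, IsAdmissible π D s v ∧ c = Finsupp.single v 1}

/-- The group of degenerate admissible cycles: it is generated by the pullbacks of the admissible
cycles along the projections forgetting one coordinate of the cube. -/
def degCycles (D : X.IdealSheafData) (s : ℤ) : (n : ℕ) → AddSubgroup (Cyc (XCube π n))
  | 0 => ⊥
  | n + 1 => ⨆ i : Fin (n + 1), (admCycles π D s n).map (cyclePullback (degenMap π n i))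

/-- The boundary `∂ = ∑ᵢ (-1)^i (∂_i^0 - ∂_i^1)`, where `i` runs from `1` to `n + 1` and `∂_i^ε` is
the pullback to the face `y_i = ε`. -/
def bdry (n : ℕ) : Cyc (XCube π (n + 1)) →+ Cyc (XCube π n) :=
  ∑ i : Fin (n + 1), ((-1 : ℤ) ^ ((i : ℕ) + 1)) •
    (cyclePullback (faceMap π n i 0) - cyclePullback (faceMap π n i 1))

/-- The term `z_s(X|D, n)` of the cycle complex: admissible cycles modulo degenerate ones. -/
abbrev ZGroup (D : X.IdealSheafData) (s : ℤ) (n : ℕ) : Type u :=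
  admCycles π D s n ⧸ (degCycles π D s n).addSubgroupOf (admCycles π D s n)

/-- Admissible cycles whose class in `z_s(X|D, n)` is annihilated by the boundary, that is, whose
boundary is degenerate. -/
def closedCycles (D : X.IdealSheafData) (s : ℤ) : (n : ℕ) → AddSubgroup (Cyc (XCube π n))
  | 0 => admCycles π D s 0
  | n + 1 => admCycles π D s (n + 1) ⊓ (degCycles π D s n).comap (bdry π n)

/-- Cycles representing boundaries in `z_s(X|D, n)`: sums of a degenerate cycle and the boundary of
an admissible cycle. -/
def boundaryCycles (D : X.IdealSheafData) (s : ℤ) (n : ℕ) : AddSubgroup (Cyc (XCube π n)) :=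
  degCycles π D s n ⊔ (admCycles π D s (n + 1)).map (bdry π n)

/-- The higher Chow group with modulus `CH_s(X|D, n) = H_n(z_s(X|D, •))`: the kernel of the boundary
on admissible modulo degenerate cycles, modulo its image, both written as groups of cycles. -/
abbrev CHGroup (D : X.IdealSheafData) (s : ℤ) (n : ℕ) : Type u :=
  closedCycles π D s n ⧸ (boundaryCycles π D s n).addSubgroupOf (closedCycles π D s n)

end Cycles

end ModulusCycles

end

noncomputable section

namespace ModulusCycles

attribute [local instance] MvPolynomial.gradedAlgebra

/-! No admissible cycle exists when `s > 0` (`not_isAdmissible`), so every group in sight is zero.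
The modulus condition forces the part of ν^*D lying over V into ν^*F_n^∞, which is empty over □^n;
hence V misses D × □^n (`ModulusCondition.notMem_support`). Since D is ample, sections of 𝒪(nD)
become functions off D, and V, being affine over X, is quasi-affine (`isQuasiAffine_of_isAmpleDiv`).
As X is projective, V is also proper over the affine scheme □^n, hence affine
(`isAffine_of_isProper_of_isQuasiAffine`) and then finite over □^n. So dim V ≤ n, against dim V = s
+ n. -/

/-! ### The modulus condition and supports -/

lemma support_le_of_divLE {X : Scheme.{u}} {I₁ I₂ : X.IdealSheafData} (h : DivLE I₁ I₂) :
    I₁.support ≤ I₂.support := by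
  obtain ⟨-, -, J, -, rfl⟩ := h
  rw [Scheme.IdealSheafData.support_mul]
  exact le_sup_left

/-- The normalization map is integral, hence closed, and its image contains `y` because Spec κ(y) →
Y factors through it. -/
lemma range_normalizationAtMap (Y : Scheme.{u}) (y : Y) :
    closure {y} ⊆ Set.range (normalizationAtMap Y y) := by
  have : IsIntegralHom (normalizationAtMap Y y) := by
    unfold normalizationAtMap normalizationAt; infer_instance
  refine closure_minimal ?_ (normalizationAtMap Y y).isClosedMap.isClosed_range
  rw [← Scheme.range_fromSpecResidueField y,
    ← (Y.fromSpecResidueField y).toNormalization_fromNormalization]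
  rintro _ ⟨x, rfl⟩
  rw [Scheme.Hom.comp_apply]
  exact ⟨_, rfl⟩

@[simp]
lemma support_inftyIdeal (k : Type u) [Field k] :
    ((inftyIdeal k).support : Set (projSpace k 1)) =
      (Proj.basicOpen (MvPolynomial.homogeneousSubmodule (Fin (1 + 1)) k)
        (MvPolynomial.X 1) : Set _)ᶜ := by
  rfl

/-- The point ∞ is {Y_1 = 0}, and Y_1 pulls back to the unit 1 along [y_i : 1]. -/
lemma cubeCoord_notMem_support (k : Type u) [Field k] {n : ℕ} (i : Fin n) (z : cube k n) :
    cubeCoord k i z ∉ (inftyIdeal k).support := by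
  rw [← SetLike.mem_coe, support_inftyIdeal, Set.notMem_compl_iff]
  change z ∈ cubeCoord k i ⁻¹ᵁ Proj.basicOpen (MvPolynomial.homogeneousSubmodule (Fin (1 + 1)) k)
    (MvPolynomial.X 1)
  rw [cubeCoord, Proj.fromOfGlobalSections_preimage_basicOpen _ _ _ one_pos
    (MvPolynomial.isHomogeneous_X k (1 : Fin (1 + 1)))]
  have h1 : coordHom k i (MvPolynomial.X 1) = 1 := by
    change (Scheme.ΓSpecIso (.of (MvPolynomial (Fin n) k))).inv.hom
      (MvPolynomial.aeval (R := k)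
        (![MvPolynomial.X i, 1] : Fin (1 + 1) → MvPolynomial (Fin n) k) (MvPolynomial.X 1)) = _
    rw [MvPolynomial.aeval_X]
    exact map_one _
  rw [h1, Scheme.basicOpen_of_isUnit _ isUnit_one]
  trivial

lemma support_prod {Y : Scheme.{u}} {ι : Type*} (s : Finset ι) (I : ι → Y.IdealSheafData) (y : Y)
    (hy : y ∈ (∏ i ∈ s, I i).support) : ∃ i ∈ s, y ∈ (I i).support := by
  classical
  induction s using Finset.induction_on with
  | empty =>
    rw [Finset.prod_empty] at hy
    exact hy.elim
  | insert a s ha ih =>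
    rw [Finset.prod_insert ha, Scheme.IdealSheafData.support_mul] at hy
    rcases hy with hy | hy
    · exact ⟨a, by simp, hy⟩
    · obtain ⟨i, hi, h⟩ := ih hy
      exact ⟨i, by simp [hi], h⟩

lemma cubeEmb_notMem_support (k : Type u) [Field k] {n : ℕ} (z : cube k n) :
    cubeEmb k n z ∉ (cubeInfty k n).support := by
  intro hz
  obtain ⟨i, -, hi⟩ := support_prod _ _ _ hz
  rw [Scheme.IdealSheafData.support_comap] at hi
  change cubeBarProj k i (cubeEmb k n z) ∈ (inftyIdeal k).support at hi
  rw [← Scheme.Hom.comp_apply, cubeEmb, cubeBarProj, WidePullback.lift_π] at hi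
  exact cubeCoord_notMem_support k i z hi

lemma ModulusCondition.notMem_support {k : Type u} [Field k] {X : Scheme.{u}}
    {π : X ⟶ Spec (.of k)} {D : X.IdealSheafData} {n : ℕ} {v : XCube π n}
    (h : ModulusCondition π D v) {z : XCube π n} (hz : z ∈ closure {v}) :
    pullback.fst π (cubeStr k n) z ∉ D.support := by
  intro hzD
  have h1 : XCubeEmb π n z ∈ closure {XCubeEmb π n v} := by
    have := image_closure_subset_closure_image (XCubeEmb π n).continuous
      (Set.mem_image_of_mem _ hz)
    rwa [Set.image_singleton] at this
  -- The modulus condition lives on the normalization, so the point is lifted there and the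
  -- resulting inclusion of supports is read off at its image.
  obtain ⟨w, hw⟩ := range_normalizationAtMap _ _ h1
  have h2 : w ∈ Scheme.IdealSheafData.support _ → w ∈ Scheme.IdealSheafData.support _ :=
    fun hw => support_le_of_divLE h hw
  rw [Scheme.IdealSheafData.support_comap, Scheme.IdealSheafData.support_comap,
    Scheme.IdealSheafData.support_comap, Scheme.IdealSheafData.support_comap] at h2
  change pullback.fst π (cubeBarStr k n) (normalizationAtMap _ _ w) ∈ D.support →
    pullback.snd π (cubeBarStr k n) (normalizationAtMap _ _ w) ∈ (cubeInfty k n).support at h2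
  rw [hw, ← Scheme.Hom.comp_apply, ← Scheme.Hom.comp_apply, XCubeEmb, pullback.lift_fst,
    pullback.lift_snd, Scheme.Hom.comp_apply] at h2
  exact cubeEmb_notMem_support k _ (h2 hzD)

/-! ### Sections of 𝒪_X(nD) off the divisor -/

/-- The complement of the closed subscheme with ideal sheaf `I`. -/
def complOpens {X : Scheme.{u}} (I : X.IdealSheafData) : X.Opens :=
  ⟨(I.support : Set X)ᶜ, I.support.isClosed.isOpen_compl⟩

lemma ideal_eq_top {X : Scheme.{u}} (I : X.IdealSheafData) {W : X.affineOpens}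
    (hW : W.1 ≤ complOpens I) : I.ideal W = ⊤ := by
  have hWa : IsAffineOpen W.1 := W.2
  have h1 : hWa.fromSpec '' PrimeSpectrum.zeroLocus (I.ideal W) = (I.support : Set X) ∩ W.1 :=
    (hWa.fromSpec_image_zeroLocus _).trans (I.coe_support_inter W).symm
  have h2 : (I.support : Set X) ∩ W = ∅ := by
    rw [← Set.disjoint_iff_inter_eq_empty, Set.disjoint_right]
    exact fun x hx => hW hx
  exact PrimeSpectrum.zeroLocus_empty_iff_eq_top.mp (Set.image_eq_empty.mp (h1.trans h2))

/-- Off the divisor a section I^n → 𝒪_X can thus be evaluated at 1, which turns it into a function.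
-/
lemma one_mem_ideal_pow {X : Scheme.{u}} (I : X.IdealSheafData) (n : ℕ) {W : X.affineOpens}
    (hW : W.1 ≤ complOpens I) : (1 : Γ(X, W.1)) ∈ (I ^ n).ideal W := by
  rw [Scheme.IdealSheafData.ideal_pow, Pi.pow_apply, ideal_eq_top I hW, Ideal.top_pow]
  trivial

namespace DivSection

variable {X : Scheme.{u}} {I : X.IdealSheafData} {n : ℕ} (t : DivSection I n)

lemma toLin_one_map {U V : X.affineOpens} (h : V.1 ≤ U.1) (hU : U.1 ≤ complOpens I) :
    (X.presheaf.map (homOfLE h).op).hom (t.toLin U ⟨1, one_mem_ideal_pow I n hU⟩) =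
      t.toLin V ⟨1, one_mem_ideal_pow I n (h.trans hU)⟩ := by
  refine (t.compat U V h 1 (one_mem_ideal_pow I n hU)).symm.trans (congrArg _ (Subtype.ext ?_))
  exact map_one (X.presheaf.map (homOfLE h).op).hom

/-- Off the divisor, a section of `𝒪_X(nD)` is a regular function. -/
lemma exists_function : ∃ g : Γ(X, complOpens I), ∀ (W : X.affineOpens) (hW : W.1 ≤ complOpens I),
    (X.presheaf.map (homOfLE hW).op).hom g = t.toLin W ⟨1, one_mem_ideal_pow I n hW⟩ := by
  let ι := {W : X.affineOpens // W.1 ≤ complOpens I}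
  obtain ⟨g, hg, -⟩ := X.sheaf.existsUnique_gluing' (fun W : ι => W.1.1) (complOpens I)
    (fun W => homOfLE W.2)
    (by
      intro x hx
      obtain ⟨_, ⟨W, hW, rfl⟩, hxW, hWU⟩ :=
        X.isBasis_affineOpens.exists_subset_of_mem_open hx (complOpens I).isOpen
      exact Opens.mem_iSup.mpr ⟨⟨⟨W, hW⟩, hWU⟩, hxW⟩)
    (fun W => t.toLin W.1 ⟨1, one_mem_ideal_pow I n W.2⟩)
    (by
      intro W₁ W₂
      -- The overlap of two affine opens need not be affine, so the values at 1 are compared on the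
      -- affine opens inside it.
      let κ := {W : X.affineOpens // W.1 ≤ W₁.1.1 ⊓ W₂.1.1}
      refine X.sheaf.eq_of_locally_eq' (fun W : κ => W.1.1) _ (fun W => homOfLE W.2) ?_ _ _ ?_
      · intro x hx
        obtain ⟨_, ⟨W, hW, rfl⟩, hxW, hWU⟩ :=
          X.isBasis_affineOpens.exists_subset_of_mem_open hx (W₁.1.1 ⊓ W₂.1.1).isOpen
        exact Opens.mem_iSup.mpr ⟨⟨⟨W, hW⟩, hWU⟩, hxW⟩
      · intro W
        change (X.presheaf.map _ ≫ X.presheaf.map _).hom _ =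
          (X.presheaf.map _ ≫ X.presheaf.map _).hom _
        rw [← Functor.map_comp, ← Functor.map_comp]
        exact (t.toLin_one_map (U := W₁.1) (V := W.1) (W.2.trans inf_le_left) W₁.2).trans
          (t.toLin_one_map (U := W₂.1) (V := W.1) (W.2.trans inf_le_right) W₂.2).symm)
  exact ⟨g, fun W hW => hg ⟨W, hW⟩⟩

lemma surjective_restrict {U V : X.affineOpens} (h : V ≤ U)
    (ht : Function.Surjective (t.toLin U)) : Function.Surjective (t.toLin V) := by
  obtain ⟨⟨a, ha⟩, h1⟩ := ht 1
  intro y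
  refine ⟨y • ⟨_, (I ^ n).ideal_le_comap_ideal h ha⟩, ?_⟩
  rw [map_smul, t.compat U V h a ha, h1, map_one, smul_eq_mul, mul_one]

/-- By linearity the section is multiplication by its value at 1. -/
lemma surjective_iff_isUnit {W : X.affineOpens} (hW : W.1 ≤ complOpens I) :
    Function.Surjective (t.toLin W) ↔ IsUnit (t.toLin W ⟨1, one_mem_ideal_pow I n hW⟩) := by
  have key (a : (I ^ n).ideal W) : t.toLin W a = a.1 * t.toLin W ⟨1, one_mem_ideal_pow I n hW⟩ := by
    rw [← smul_eq_mul, ← map_smul]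
    congr 1
    exact Subtype.ext (mul_one a.1).symm
  constructor
  · intro h
    obtain ⟨a, ha⟩ := h 1
    rw [key] at ha
    exact IsUnit.of_mul_eq_one_right _ ha
  · intro h y
    obtain ⟨b, hb⟩ := h.exists_left_inv
    refine ⟨(y * b) • ⟨1, one_mem_ideal_pow I n hW⟩, ?_⟩
    rw [map_smul, smul_eq_mul, mul_assoc, hb, mul_one]

/-- With g the function glued from the values at 1, the section generates at a point off D exactly
where g is invertible. -/
lemma exists_basicOpen_eq : ∃ g : Γ(X, complOpens I),
    (X.basicOpen g : Set X) = (complOpens I : Set X) ∩ t.nonvanishing := by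
  obtain ⟨g, hg⟩ := t.exists_function
  refine ⟨g, Set.Subset.antisymm (fun x hx => ⟨X.basicOpen_le g hx, ?_⟩) ?_⟩
  · obtain ⟨_, ⟨W, hW, rfl⟩, hxW, hWU⟩ :=
      X.isBasis_affineOpens.exists_subset_of_mem_open hx (X.basicOpen g).isOpen
    have hWU : W ≤ X.basicOpen g := hWU
    have hWU' : W ≤ complOpens I := hWU.trans (X.basicOpen_le g)
    refine ⟨⟨W, hW⟩, hxW, (t.surjective_iff_isUnit hWU').mpr ?_⟩
    rw [← hg ⟨W, hW⟩ hWU']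
    have h1 := (RingedSpace.isUnit_res_basicOpen X.toRingedSpace g).map
      (X.presheaf.map (homOfLE hWU).op).hom
    change IsUnit ((X.presheaf.map (homOfLE (X.basicOpen_le g)).op ≫
      X.presheaf.map (homOfLE hWU).op).hom g) at h1
    rwa [← Functor.map_comp] at h1
  · rintro x ⟨hxU, W', hxW', hs⟩
    obtain ⟨_, ⟨W, hW, rfl⟩, hxW, hWU⟩ :=
      X.isBasis_affineOpens.exists_subset_of_mem_open
        (show x ∈ complOpens I ⊓ W'.1 from ⟨hxU, hxW'⟩) (complOpens I ⊓ W'.1).isOpen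
    have hWU : W ≤ complOpens I ⊓ W'.1 := hWU
    have h1 := t.surjective_restrict (V := ⟨W, hW⟩) (hWU.trans inf_le_right) hs
    rw [t.surjective_iff_isUnit (hWU.trans inf_le_left), ← hg ⟨W, hW⟩ (hWU.trans inf_le_left)] at h1
    have h2 := X.basicOpen_of_isUnit h1
    rw [Scheme.basicOpen_res] at h2
    exact (h2.ge hxW).2

end DivSection

/-! ### Quasi-affine, proper and finite morphisms; dimension -/

/-- A quasi-compact scheme with an affine morphism to the complement of an ample effective divisor
is quasi-affine. -/
lemma isQuasiAffine_of_isAmpleDiv {X V : Scheme.{u}} {D : X.IdealSheafData} (hD : IsAmpleDiv D)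
    [CompactSpace V] (q : V ⟶ X) [IsAffineHom q] (hq : ∀ z, q z ∉ D.support) :
    V.IsQuasiAffine := by
  refine .of_forall_exists_mem_basicOpen _ fun z => ?_
  obtain ⟨n, t, W, -, hW, hWt, hzW⟩ := hD.2 (q z)
  obtain ⟨g, hg⟩ := t.exists_basicOpen_eq
  -- Because `q` avoids D, the pullback of `g` is a global function on `V`; its basic open is the
  -- preimage of the affine `W` under the affine `q`.
  have htop : q ⁻¹ᵁ complOpens D = ⊤ := top_le_iff.mp fun z _ => hq z
  have hbo : V.basicOpen ((V.presheaf.map (eqToHom htop.symm).op).hom (q.app _ g)) = q ⁻¹ᵁ W := by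
    rw [Scheme.basicOpen_res_eq, ← Scheme.preimage_basicOpen]
    ext z
    have := Set.ext_iff.mp hg (q z)
    rw [← hWt] at this
    exact this.trans ⟨fun h => h.2, fun h => ⟨hq z, h⟩⟩
  exact ⟨_, hbo ▸ hW.preimage q, hbo ▸ hzW⟩

/-- A quasi-affine scheme that is proper over an affine scheme is affine. -/
lemma isAffine_of_isProper_of_isQuasiAffine {V B : Scheme.{u}} [IsAffine B] [V.IsQuasiAffine]
    (f : V ⟶ B) [IsProper f] : IsAffine V := by
  -- This composite is `f` followed by the isomorphism B ≅ Spec Γ(B), and properness cancels to the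
  -- first factor.
  have : IsProper (V.toSpecΓ ≫ Spec.map f.appTop) := by
    rw [← Scheme.toSpecΓ_naturality]
    infer_instance
  have : IsProper V.toSpecΓ := .of_comp V.toSpecΓ (Spec.map f.appTop)
  -- The image is closed by properness and always dense; for quasi-affine `V` the map is an open
  -- immersion, so surjectivity makes it an isomorphism.
  have : Surjective V.toSpecΓ := by
    constructor
    rw [← Set.range_eq_univ, ← V.toSpecΓ.isClosedMap.isClosed_range.closure_eq]
    exact V.toSpecΓ.denseRange.closure_range
  have : IsIso V.toSpecΓ :=
    (isIso_iff_isOpenImmersion_and_surjective _).mpr ⟨inferInstance, inferInstance⟩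
  exact .of_isIso V.toSpecΓ

/-- Incomparability: contraction along an integral map preserves strict inclusions of primes. -/
lemma ringKrullDim_le_of_isIntegral {R S : Type*} [CommRing R] [CommRing S] {φ : R →+* S}
    (hφ : φ.IsIntegral) : ringKrullDim S ≤ ringKrullDim R := by
  algebraize [φ]
  refine Order.krullDim_le_of_strictMono (PrimeSpectrum.comap φ) fun P Q hPQ => ?_
  exact Ideal.IsIntegral.comap_lt_comap (R := R) (I := P.asIdeal) (J := Q.asIdeal) hPQ

lemma topologicalKrullDim_le_of_isFinite {V : Scheme.{u}} {k : Type u} [Field k] {n : ℕ}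
    (f : V ⟶ cube k n) [IsFinite f] : topologicalKrullDim V ≤ (n : WithBot ℕ∞) := by
  have : IsAffine V := isAffine_of_isAffineHom f
  let g : Spec Γ(V, ⊤) ⟶ cube k n := V.isoSpec.inv ≫ f
  obtain ⟨φ, hφ⟩ := Spec.map_surjective g
  have hfin : IsFinite (Spec.map φ) := hφ ▸ inferInstance
  rw [IsFinite.SpecMap_iff] at hfin
  rw [IsHomeomorph.topologicalKrullDim_eq _ V.isoSpec.hom.homeomorph.isHomeomorph]
  refine (PrimeSpectrum.topologicalKrullDim_eq_ringKrullDim Γ(V, ⊤)).le.trans ?_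
  refine (ringKrullDim_le_of_isIntegral hfin.to_isIntegral).trans ?_
  exact (MvPolynomial.ringKrullDim_of_isNoetherianRing (R := k) (ι := Fin n)).le.trans
    (by simp [ringKrullDim_eq_zero_of_field])

/-! ### Properness of projective schemes -/

instance isProper_projSpaceStr (k : Type u) [Field k] (N : ℕ) : IsProper (projSpaceStr k N) := by
  have : IsScalarTower k (MvPolynomial.homogeneousSubmodule (Fin (N + 1)) k 0)
      (MvPolynomial (Fin (N + 1)) k) := ⟨fun a b c => smul_mul_assoc a b.1 c⟩
  have : Algebra.FiniteType (MvPolynomial.homogeneousSubmodule (Fin (N + 1)) k 0)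
      (MvPolynomial (Fin (N + 1)) k) := .of_restrictScalars_finiteType k _ _
  -- Degree-zero polynomials are constants, so the second factor of the structure morphism is a
  -- closed immersion.
  have hsurj : Function.Surjective
      (algebraMap k (MvPolynomial.homogeneousSubmodule (Fin (N + 1)) k 0)) := by
    rintro ⟨x, hx⟩
    rw [MvPolynomial.homogeneousSubmodule_zero, Submodule.mem_one] at hx
    obtain ⟨y, hy⟩ := hx
    exact ⟨y, Subtype.ext hy⟩
  have : IsClosedImmersion (Spec.map (CommRingCat.ofHom
      (algebraMap k (MvPolynomial.homogeneousSubmodule (Fin (N + 1)) k 0)))) :=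
    .spec_of_surjective _ hsurj
  infer_instance

lemma IsProjectiveOver.isProper {k : Type u} [Field k] {X : Scheme.{u}} {π : X ⟶ Spec (.of k)}
    (h : IsProjectiveOver π) : IsProper π := by
  obtain ⟨N, i, hi, rfl⟩ := h
  infer_instance

lemma isAffineHom_pullback_fst {X Y S : Scheme.{u}} (f : X ⟶ S) (g : Y ⟶ S)
    [hg : IsAffineHom g] : IsAffineHom (pullback.fst f g) :=
  (inferInstance : MorphismProperty.IsStableUnderBaseChange
    (@IsAffineHom : MorphismProperty Scheme.{u})).of_isPullback
      (IsPullback.of_hasPullback f g).flip hg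

/-! ### Vanishing of the cycle groups -/

/-- There are no admissible cycles of positive relative dimension with ample modulus: such a cycle
avoids the divisor, hence is quasi-affine, and it is proper over the cube, hence finite over it. -/
lemma not_isAdmissible {k : Type u} [Field k] {X : Scheme.{u}} {π : X ⟶ Spec (.of k)}
    (hX : IsProjectiveOver π) {D : X.IdealSheafData} (hample : IsAmpleDiv D)
    {s : ℤ} (hs : 0 < s) {n : ℕ} (v : XCube π n) : ¬ IsAdmissible π D s v := by
  intro h
  have := hX.isProper
  let Z := Scheme.IdealSheafData.vanishingIdeal (X := XCube π n) ⟨closure {v}, isClosed_closure⟩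
  have hZ : Set.range Z.subschemeι = closure {v} := Z.range_subschemeι
  let p := Z.subschemeι ≫ pullback.snd π (cubeStr k n)
  -- □^n is affine over k, so X × □^n → X is affine, and so is its restriction `q` to the cycle.
  have := isAffineHom_pullback_fst π (cubeStr k n)
  let q := Z.subschemeι ≫ pullback.fst π (cubeStr k n)
  have : CompactSpace Z.subscheme := QuasiCompact.compactSpace_of_compactSpace p
  have : Z.subscheme.IsQuasiAffine := isQuasiAffine_of_isAmpleDiv hample q fun z => by
    rw [Scheme.Hom.comp_apply]
    exact h.modulus.notMem_support (hZ ▸ Set.mem_range_self z)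
  have : IsAffine Z.subscheme := isAffine_of_isProper_of_isQuasiAffine p
  have : IsFinite p := (IsFinite.iff_isProper_and_isAffineHom).mpr ⟨inferInstance, inferInstance⟩
  have h1 := topologicalKrullDim_le_of_isFinite p
  have h2 : topologicalKrullDim ↥(closure {v}) = topologicalKrullDim Z.subscheme := by
    rw [← hZ]
    exact (Z.subschemeι.isEmbedding.toHomeomorph.isHomeomorph.topologicalKrullDim_eq).symm
  obtain ⟨m, hm, hms⟩ := h.dim
  rw [← h2, hm] at h1
  have h3 : m ≤ n := by exact_mod_cast h1
  omega

end ModulusCycles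

end

theorem mainTheorem7 {k : Type u} [Field k] {X : Scheme.{u}} (π : X ⟶ Spec (.of k))
    (hX : ModulusCycles.IsProjectiveOver π) (d : ℕ) (hd : 1 ≤ d)
    (hdim : topologicalKrullDim X = (d : WithBot ℕ∞))
    (D : X.IdealSheafData) (hD : ModulusCycles.IsEffCartier D)
    (hample : ModulusCycles.IsAmpleDiv D)
    (s : ℤ) (hs : 0 < s) (p : ℕ) :
    Subsingleton (ModulusCycles.ZGroup π D s p) ∧
      Subsingleton (ModulusCycles.CHGroup π D s p) := by
  have hadm (n : ℕ) : ModulusCycles.admCycles π D s n = ⊥ := by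
    rw [ModulusCycles.admCycles, AddSubgroup.closure_eq_bot_iff]
    rintro _ ⟨v, hv, -⟩
    exact (ModulusCycles.not_isAdmissible hX hample hs v hv).elim
  -- Closed cycles are admissible by definition, so they vanish as well.
  have hclosed : ModulusCycles.closedCycles π D s p = ⊥ := by
    cases p with
    | zero => exact hadm 0
    | succ n => rw [ModulusCycles.closedCycles, hadm, bot_inf_eq]
  have hsub {A : Type u} [AddCommGroup A] {G : AddSubgroup A} (hG : G = ⊥) (H : AddSubgroup G) :
      Subsingleton (G ⧸ H) := by
    subst hG
    exact (QuotientAddGroup.mk_surjective (s := H)).subsingleton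
  exact ⟨hsub (hadm p) _, hsub hclosed _⟩
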